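/- Let $\mathbb D=\{z\in\mathbb C:|z|<1\}$ and let $\mathcal A$ be the class of analytic functions $f:\mathbb D\to\mathbb C$ with $f(0)=0$ and $f'(0)=1$. Let $\mathcal F(3)$ be the class of all $f\in\mathcal A$ such that $f'$ has no zero in $\mathbb D$ and $$\operatorname{Re}\left(1+\frac{zf''(z)}{f'(z)}\right)>-\frac12\qquad(z\in\mathbb D).$$ The logarithmic coefficients $\gamma_n=\gamma_n(f)$, $n\ge1$, of $f\in\mathcal A$ are defined by $$\log\frac{f(z)}{z}=2\sum_{n=1}^{\infty}\gamma_n(f)\,z^n ,$$ where $f(z)/z$ is given the value $1$ at $z=0$, the branch of the logarithm vanishes at $z=0$, and the expansion is taken near $z=0$ (for univalent $f$ it holds in all of $\mathbb D$). (a) For every $f\in\mathcal F(3)$, $$|\gamma_1|\le\frac34,\qquad |\gamma_2|\le\frac7{16},\qquad |\gamma_3|\le\frac5{16},$$ $$|\gamma_4|\le\frac1{40}\left(5+\frac{19}{2}\sqrt{\frac{76}{303}}\right),\qquad |\gamma_5|\le\frac1{60}\left(\frac{69}{8}+\frac{33}{4}\sqrt{\frac{22}{83}}\right).$$ (b) The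 function $$f_3(z)=\frac{z-z^2/2}{(1-z)^2}$$ belongs to $\mathcal F(3)$, and the first three inequalities are sharp for it: $|\gamma_1(f_3)|=\frac34$, $|\gamma_2(f_3)|=\frac7{16}$, $|\gamma_3(f_3)|=\frac5{16}$. (c) For every integer $k\ge1$, $$\gamma_k(f_3)=\left(1-\frac1{2^{k+1}}\right)\frac1k .$$ -/

import Mathlib

/-- The class `𝒜`: functions analytic in the open unit disk with `f(0) = 0` and `f'(0) = 1`.
Functions are total on `ℂ`; only their values in the open unit disk matter. -/
def ClassA : Set (ℂ → ℂ) :=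
  {f | DifferentiableOn ℂ f (Metric.ball 0 1) ∧ f 0 = 0 ∧ deriv f 0 = 1}

/-- The class `ℱ(c)`: functions `f ∈ 𝒜` with `Re (1 + z f''(z) / f'(z)) > 1 - c / 2` in the unit
disk. The quotient is meaningful only where `f'` does not vanish, so this is part of the
condition. -/
def ClassF (c : ℝ) : Set (ℂ → ℂ) :=
  {f | f ∈ ClassA ∧ ∀ z ∈ Metric.ball (0 : ℂ) 1,
    deriv f z ≠ 0 ∧ 1 - c / 2 < (1 + z * deriv (deriv f) z / deriv f z).re}

/-- The `n`-th logarithmic coefficient of `f ∈ 𝒜`: half the `n`-th Taylor coefficient at `0` of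
`log (f(z) / z)`. Here `dslope f 0` is `f(z) / z` with its removable singularity at `0` filled in by
`f'(0) = 1`, so the principal branch of the logarithm is analytic near `0` and vanishes at `0`.
The lemmas `logCoeff_eq_of_hasSum` and `exists_log_hasSum_logCoeff` say that these are the
coefficients in `log (f(z) / z) = 2 ∑ γₙ zⁿ` on the whole unit disk. -/
noncomputable def logCoeff (f : ℂ → ℂ) (n : ℕ) : ℂ :=
  iteratedDeriv n (fun z => Complex.log (dslope f 0 z)) 0 / (2 * (n.factorial : ℂ))

/-- The function `f₃(z) = (z - z² / 2) / (1 - z)²`. -/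
noncomputable def fThree : ℂ → ℂ := fun z => (z - z ^ 2 / 2) / (1 - z) ^ 2

theorem ClassA.dslope_eq {f : ℂ → ℂ} (hf : f ∈ ClassA) {z : ℂ} (hz : z ≠ 0) :
    dslope f 0 z = f z / z := by
  rw [dslope_of_ne _ hz, slope_def_field, hf.2.1]; simp

/-- Any analytic branch near `0` of `log (f(z) / z)` that vanishes at `0` has the Taylor
coefficients `2 * logCoeff f n`. -/
theorem two_mul_logCoeff {f g : ℂ → ℂ} (hg : ContinuousAt g 0) (h0 : g 0 = 0)
    (hexp : ∀ᶠ z in nhds 0, Complex.exp (g z) = dslope f 0 z) (n : ℕ) :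
    2 * logCoeff f n = (n.factorial : ℂ)⁻¹ * iteratedDeriv n g 0 := by
  have him : ∀ᶠ z in nhds (0 : ℂ), |(g z).im| < Real.pi := by
    have hc : ContinuousAt (fun z => |(g z).im|) 0 :=
      (Complex.continuous_im.continuousAt.comp hg).abs
    refine hc.eventually_lt continuousAt_const ?_
    simpa [h0] using Real.pi_pos
  have heq : (fun z => Complex.log (dslope f 0 z)) =ᶠ[nhds 0] g := by
    filter_upwards [him, hexp] with z h1 h2
    rw [← h2, Complex.log_exp (abs_lt.1 h1).1 (abs_lt.1 h1).2.le]
  have hfac : (n.factorial : ℂ) ≠ 0 := by exact_mod_cast n.factorial_ne_zero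
  rw [logCoeff, heq.iteratedDeriv_eq n]
  field_simp

/-- If `log (f(z) / z) = 2 ∑ γₙ zⁿ` in the unit disk, for an analytic branch of the logarithm that
vanishes at `0`, then `γₙ` is `logCoeff f n`. -/
theorem logCoeff_eq_of_hasSum {f g : ℂ → ℂ} {γ : ℕ → ℂ} (hf : f ∈ ClassA)
    (hg : DifferentiableOn ℂ g (Metric.ball 0 1))
    (hexp : ∀ z ∈ Metric.ball (0 : ℂ) 1, z ≠ 0 → Complex.exp (g z) = f z / z)
    (hsum : ∀ z ∈ Metric.ball (0 : ℂ) 1, HasSum (fun n : ℕ => 2 * γ (n + 1) * z ^ (n + 1)) (g z))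
    (n : ℕ) (hn : 1 ≤ n) : logCoeff f n = γ n := by
  have hball : Metric.ball (0 : ℂ) 1 ∈ nhds 0 := Metric.ball_mem_nhds 0 one_pos
  have hg0 : g 0 = 0 := by
    have h := hsum 0 (Metric.mem_ball_self one_pos)
    refine h.unique ?_
    simp
  have hga : AnalyticAt ℂ g 0 := hg.analyticAt hball
  have hev : ∀ᶠ z in nhds (0 : ℂ), Complex.exp (g z) = dslope f 0 z := by
    filter_upwards [hball] with z hz
    by_cases h : z = 0
    · rw [h, hg0, dslope_same, hf.2.2, Complex.exp_zero]
    · rw [hexp z hz h, ClassA.dslope_eq hf h]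
  have hkey := two_mul_logCoeff hga.continuousAt hg0 hev n
  let a : ℕ → ℂ := fun m => if m = 0 then 0 else 2 * γ m
  have hp : HasFPowerSeriesAt g (FormalMultilinearSeries.ofScalars ℂ a) 0 := by
    rw [hasFPowerSeriesAt_iff]
    filter_upwards [hball] with z hz
    have h := hsum z hz
    rw [zero_add, ← hasSum_nat_add_iff' 1]
    simpa [a, FormalMultilinearSeries.coeff_ofScalars, mul_comm] using h
  have hcoeff := congrArg (fun p => FormalMultilinearSeries.coeff p n)
    (hp.eq_formalMultilinearSeries hga.hasFPowerSeriesAt)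
  simp only [FormalMultilinearSeries.coeff_ofScalars, a, if_neg (Nat.one_le_iff_ne_zero.1 hn)]
    at hcoeff
  have h2 : 2 * logCoeff f n = 2 * γ n := by rw [hkey, hcoeff, div_eq_inv_mul]
  exact mul_left_cancel₀ two_ne_zero h2

/-- For every univalent `f ∈ 𝒜` the expansion `log (f(z) / z) = 2 ∑ γₙ zⁿ` holds in the whole unit
disk with `γₙ = logCoeff f n`. -/
theorem exists_log_hasSum_logCoeff {f : ℂ → ℂ} (hf : f ∈ ClassA)
    (hinj : Set.InjOn f (Metric.ball 0 1)) :
    ∃ g : ℂ → ℂ, DifferentiableOn ℂ g (Metric.ball 0 1) ∧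
      (∀ z ∈ Metric.ball (0 : ℂ) 1, z ≠ 0 → Complex.exp (g z) = f z / z) ∧
      ∀ z ∈ Metric.ball (0 : ℂ) 1,
        HasSum (fun n : ℕ => 2 * logCoeff f (n + 1) * z ^ (n + 1)) (g z) := by
  have hball : Metric.ball (0 : ℂ) 1 ∈ nhds 0 := Metric.ball_mem_nhds 0 one_pos
  have h0mem : (0 : ℂ) ∈ Metric.ball (0 : ℂ) 1 := Metric.mem_ball_self one_pos
  set q : ℂ → ℂ := dslope f 0 with hq
  have hqd : DifferentiableOn ℂ q (Metric.ball 0 1) :=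
    (Complex.differentiableOn_dslope hball).2 hf.1
  have hq0 : q 0 = 1 := by rw [hq, dslope_same, hf.2.2]
  have hqne : ∀ z ∈ Metric.ball (0 : ℂ) 1, q z ≠ 0 := by
    intro z hz
    by_cases h : z = 0
    · rw [h, hq0]; exact one_ne_zero
    · rw [hq, ClassA.dslope_eq hf h]
      refine div_ne_zero (fun hfz => h (hinj hz h0mem ?_)) h
      rw [hfz, hf.2.1]
  have hq' : DifferentiableOn ℂ (fun z => deriv q z / q z) (Metric.ball 0 1) :=
    (hqd.deriv Metric.isOpen_ball).div hqd hqne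
  obtain ⟨g, hg0, hg⟩ := hq'.isExactOn_ball.with_val_at 0 0
  have hgd : DifferentiableOn ℂ g (Metric.ball 0 1) :=
    fun z hz => (hg z hz).differentiableAt.differentiableWithinAt
  have hexp : ∀ z ∈ Metric.ball (0 : ℂ) 1, Complex.exp (g z) = q z := by
    have hder : ∀ z ∈ Metric.ball (0 : ℂ) 1,
        HasDerivAt (fun w => Complex.exp (- g w) * q w) 0 z := by
      intro z hz
      have h1 := (hqd.differentiableAt (Metric.isOpen_ball.mem_nhds hz)).hasDerivAt
      have h2 := ((hg z hz).neg.cexp).mul h1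
      refine h2.congr_deriv ?_
      have := hqne z hz
      simp only [Pi.neg_apply]
      field_simp
      ring
    intro z hz
    have hconst := Metric.isOpen_ball.is_const_of_deriv_eq_zero
      (convex_ball (0 : ℂ) 1).isPreconnected
      (fun w hw => (hder w hw).differentiableAt.differentiableWithinAt)
      (fun w hw => (hder w hw).deriv) hz h0mem
    simp only [hg0, hq0, neg_zero, Complex.exp_zero, mul_one, Complex.exp_neg] at hconst
    have := Complex.exp_ne_zero (g z)
    field_simp at hconst
    exact hconst.symm
  refine ⟨g, hgd, fun z hz h => by rw [hexp z hz, hq, ClassA.dslope_eq hf h], fun z hz => ?_⟩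
  have hT := Complex.hasSum_taylorSeries_on_ball hgd hz
  rw [← hasSum_nat_add_iff' 1] at hT
  simp only [Finset.sum_range_one, iteratedDeriv_zero, hg0, smul_zero, sub_zero] at hT
  have hev : ∀ᶠ w in nhds (0 : ℂ), Complex.exp (g w) = dslope f 0 w := by
    filter_upwards [hball] with w hw using hexp w hw
  have hcoef := two_mul_logCoeff (hg 0 h0mem).continuousAt hg0 hev
  have hfun : (fun n : ℕ => 2 * logCoeff f (n + 1) * z ^ (n + 1)) = fun n : ℕ =>
      ((n + 1).factorial : ℂ)⁻¹ • z ^ (n + 1) • iteratedDeriv (n + 1) g 0 := by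
    funext n
    rw [hcoef (n + 1), smul_eq_mul, smul_eq_mul]
    ring
  rw [hfun]
  exact hT

/-! For `f ∈ ℱ(3)` the function `p = 1 + (2/3) z f''/f'` (`classFRe`) is a Carathéodory function.
With `q = z f'/f - 1`, whose coefficients are `2 n γ_n`, logarithmic differentiation gives `(3/2)(1
+ q)(p - 1) = (1 + q) q + z q'`. The coefficient of `z^n` determines `(n + 1) q_n` from `p_1, …,
p_n` and earlier `q_j`, so each `γ_n` is a polynomial in the `p_j` (`logCoeff_eq_caratheodory`).

For `n ≤ 3` these polynomials have nonnegative coefficients, so `|p_j| ≤ 2` suffices. It is sharp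
when all `p_j = 2`, that is `p = (1 + z)/(1 - z)`, which belongs to `f₃`. For `n = 4, 5` a negative
cubic term appears; it is kept inside a bracket `p_3 + A p_1 p_2 - B p_1^3`, and everything outside
has nonnegative coefficients.

The brackets need a Prokhorov–Szynal estimate of `|c_3 + μ c_1 c_2 + ν c_1^3|` for the coefficients
of a Schwarz function. Schur parameters `a, b, d` turn it into a maximisation over `|a|`, `|b|` and
one real part (`schur_bound_real`). The maximum comes from the cubic `(μ + 1) x - (μ + 1 + ν) x^3`,
which is where the square roots originate. The coefficients of `f₃` come from an explicit logarithm.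
-/

/-! ### Maximising a cubic coefficient functional over Schur parameters. -/

/-- The quadratic form `|s (μ β - β²) + ν X|²` for `|β| = y`, `Re β = k`, completed to a square. -/
theorem four_mul_form_add_sq (μ ν s X y k : ℝ) :
    4 * ν * X * (s ^ 2 * y ^ 2 * (μ ^ 2 + y ^ 2) - 2 * μ * s ^ 2 * y ^ 2 * k
        + 2 * s * ν * X * (μ * k - 2 * k ^ 2 + y ^ 2) + ν ^ 2 * X ^ 2)
      + s * (μ * (ν * X - s * y ^ 2) - 4 * ν * X * k) ^ 2
      = (s * y ^ 2 + ν * X) ^ 2 * (4 * ν * X + s * μ ^ 2) := by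
  ring

/-- Maximisation over `y` and `k` of the bound for `|c₃ + μ c₁ c₂ + ν c₁³|` in terms of Schur
parameters. -/
theorem schur_bound_real {μ ν M : ℝ} (hμ : 0 < μ) (hν : 0 < ν) (hM : 1 ≤ M) (hμν : 4 * ν ≤ μ ^ 2)
    (hA : ∀ x y : ℝ, 0 ≤ x → x ≤ 1 → 0 ≤ y → y ≤ 1 → x ^ 2 * (μ + ν * (4 + μ)) ≤ μ →
      ν * x ≤ 1 ∧ (1 - x ^ 2) * (1 - y ^ 2) + x * ((1 - x ^ 2) * (μ * y + y ^ 2) - ν * x ^ 2) ≤ M)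
    (hB : ∀ X : ℝ, X ≤ 1 → μ ≤ X * (μ + ν * (4 + μ)) →
      (1 - X + ν * X) ^ 2 * (X + (1 - X) * (μ ^ 2 / (4 * ν))) ≤ M ^ 2)
    {x y k Q : ℝ} (hx0 : 0 ≤ x) (hx1 : x ≤ 1) (hy0 : 0 ≤ y) (hy1 : y ≤ 1) (hk : -y ≤ k)
    (hQ0 : 0 ≤ Q)
    (hQ : Q ^ 2 = (1 - x ^ 2) ^ 2 * y ^ 2 * (μ ^ 2 + y ^ 2) - 2 * μ * (1 - x ^ 2) ^ 2 * y ^ 2 * k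
        + 2 * (1 - x ^ 2) * ν * x ^ 2 * (μ * k - 2 * k ^ 2 + y ^ 2) + ν ^ 2 * (x ^ 2) ^ 2) :
    (1 - x ^ 2) * (1 - y ^ 2) + x * Q ≤ M := by
  obtain ⟨X, hX⟩ : ∃ X, X = x ^ 2 := ⟨_, rfl⟩
  obtain ⟨s, hs⟩ : ∃ s, s = 1 - X := ⟨_, rfl⟩
  have hX0 : 0 ≤ X := hX ▸ sq_nonneg x
  have hX1 : X ≤ 1 := by rw [hX]; nlinarith
  have hs0 : 0 ≤ s := by linarith
  have hr1 : (1 : ℝ) ≤ μ ^ 2 / (4 * ν) := by rw [le_div_iff₀ (by positivity)]; linarith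
  set S : ℝ := Real.sqrt (X + s * (μ ^ 2 / (4 * ν))) with hS
  have hin : 1 ≤ X + s * (μ ^ 2 / (4 * ν)) := by
    linarith [mul_nonneg hs0 (sub_nonneg.2 hr1)]
  have hS2 : S ^ 2 = X + s * (μ ^ 2 / (4 * ν)) := Real.sq_sqrt (by linarith)
  have hS1 : 1 ≤ S := Real.one_le_sqrt.2 hin
  have hS4 : 4 * ν * S ^ 2 = 4 * ν * X + s * μ ^ 2 := by rw [hS2]; field_simp
  rw [← hX, ← hs] at hQ ⊢
  have hR : 0 ≤ s * y ^ 2 + ν * X := by positivity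
  -- Dropping the completed square bounds `Q` independently of `k`, by its value at the vertex of
  -- the quadratic in `k`.
  have hxQ : x * Q ≤ (s * y ^ 2 + ν * X) * S := by
    refine (abs_le_of_sq_le_sq' ?_ (by positivity)).2
    have h1 := four_mul_form_add_sq μ ν s X y k
    rw [← hQ, ← hS4] at h1
    have h2 : 0 ≤ s * (μ * (ν * X - s * y ^ 2) - 4 * ν * X * k) ^ 2 := by positivity
    have h3 : 4 * ν * (x * Q) ^ 2 ≤ 4 * ν * ((s * y ^ 2 + ν * X) * S) ^ 2 := by
      rw [mul_pow, ← hX]; linarith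
    exact le_of_mul_le_mul_left h3 (by positivity)
  -- The vertex majorant increases with `y` because `S ≥ 1`, which is where `4 ν ≤ μ ^ 2` enters.
  have hmono : ∀ z : ℝ, y ≤ z → s * (1 - y ^ 2) + (s * y ^ 2 + ν * X) * S ≤
      s * (1 - z ^ 2) + (s * z ^ 2 + ν * X) * S := by
    intro z hz
    have h1 : 0 ≤ z ^ 2 - y ^ 2 := by nlinarith
    have h2 := mul_nonneg (mul_nonneg hs0 h1) (sub_nonneg.2 hS1)
    linarith
  -- The threshold decides whether, at `y = 1`, the vertex in `k` lies at or to the right of `-1`.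
  rcases le_total μ (X * (μ + ν * (4 + μ))) with hc | hc
  · have h1 := hmono 1 hy1
    have h2 : (s + ν * X) * S ≤ M := by
      refine (abs_le_of_sq_le_sq' ?_ (by linarith)).2
      rw [mul_pow, hS2, hs]
      exact hB X hX1 hc
    linarith
  · have habs : ∀ z : ℝ, 0 ≤ z → z ≤ 1 →
        s * (1 - z ^ 2) + x * |s * (μ * z + z ^ 2) - ν * X| ≤ M := by
      intro z hz0 hz1
      obtain ⟨h1, h2⟩ := hA x z hx0 hx1 hz0 hz1 (by rwa [← hX])
      rw [← hX, ← hs] at h2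
      -- With the opposite sign, `ν x ≤ 1` already gives a total of at most `s + X = 1 ≤ M`.
      rcases abs_cases (s * (μ * z + z ^ 2) - ν * X) with ⟨h, -⟩ | ⟨h, -⟩
      · rwa [h]
      · rw [h]
        have h3 : 0 ≤ x * (s * (μ * z + z ^ 2)) := by positivity
        have h4 : 0 ≤ s * z ^ 2 := by positivity
        have h5 : (ν * x) * X ≤ 1 * X := mul_le_mul_of_nonneg_right h1 hX0
        rw [hs] at h3 h4 ⊢
        rw [hX] at h3 h4 h5 ⊢
        linarith
    -- If the vertex lies at or to the left of `-y`, concavity in `k` puts the maximum at `k = -y`,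
    -- that is `β = -y`. Otherwise `y` is raised to a `z` whose vertex is exactly `-z`; there the
    -- square in `four_mul_form_add_sq` vanishes, so the majorant equals the value at `β = -z`.
    rcases le_or_gt (4 * ν * X * y) (μ * (s * y ^ 2 - ν * X)) with hg | hg
    · refine le_trans ?_ (habs y hy0 hy1)
      have h1 : Q ≤ |s * (μ * y + y ^ 2) - ν * X| := by
        rw [← abs_of_nonneg hQ0]
        refine sq_le_sq.1 ?_
        have hνX : 0 ≤ ν * X := by positivity
        have h2 : 0 ≤ (y + k) * (2 * s * (μ * (s * y ^ 2 - ν * X) - 2 * ν * X * (y - k))) := by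
          have h3 : 0 ≤ ν * X * (y + k) := mul_nonneg hνX (by linarith)
          exact mul_nonneg (by linarith) (mul_nonneg (by linarith) (by linarith))
        have h4 : (s * (μ * y + y ^ 2) - ν * X) ^ 2 - Q ^ 2 =
            (y + k) * (2 * s * (μ * (s * y ^ 2 - ν * X) - 2 * ν * X * (y - k))) := by
          rw [hQ]; ring
        linarith
      gcongr
    · have hcont : ContinuousOn (fun z : ℝ => μ * (s * z ^ 2 - ν * X) - 4 * ν * X * z)
          (Set.Icc y 1) := by fun_prop
      obtain ⟨z, ⟨hyz, hz1⟩, hz⟩ := intermediate_value_Icc hy1 hcont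
        (show (0 : ℝ) ∈ Set.Icc _ _ from ⟨by linarith, by rw [hs]; linarith⟩)
      have hz0 := hy0.trans hyz
      have h1 := habs z hz0 hz1
      have h2 := hmono z hyz
      have h3 : (s * z ^ 2 + ν * X) * S ≤ x * |s * (μ * z + z ^ 2) - ν * X| := by
        refine (abs_le_of_sq_le_sq' ?_ (by positivity)).2
        rw [mul_pow, mul_pow, sq_abs, ← hX]
        refine le_of_mul_le_mul_left (a := 4 * ν) ?_ (by positivity)
        have h4 := four_mul_form_add_sq μ ν s X z (-z)
        have h5 : μ * (ν * X - s * z ^ 2) - 4 * ν * X * (-z) = 0 := by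
          simp only at hz; linarith
        rw [h5, ← hS4] at h4
        exact le_of_eq (by linear_combination -h4)
      linarith

/-- A coefficient bound of Prokhorov and Szynal in terms of the Schur parameters `a`, `b`, `d`. -/
theorem schur_bound_complex {μ ν M : ℝ} (hμ : 0 < μ) (hν : 0 < ν) (hM : 1 ≤ M)
    (hμν : 4 * ν ≤ μ ^ 2)
    (hA : ∀ x y : ℝ, 0 ≤ x → x ≤ 1 → 0 ≤ y → y ≤ 1 → x ^ 2 * (μ + ν * (4 + μ)) ≤ μ →
      ν * x ≤ 1 ∧ (1 - x ^ 2) * (1 - y ^ 2) + x * ((1 - x ^ 2) * (μ * y + y ^ 2) - ν * x ^ 2) ≤ M)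
    (hB : ∀ X : ℝ, X ≤ 1 → μ ≤ X * (μ + ν * (4 + μ)) →
      (1 - X + ν * X) ^ 2 * (X + (1 - X) * (μ ^ 2 / (4 * ν))) ≤ M ^ 2)
    {a b d : ℂ} (ha : ‖a‖ ≤ 1) (hb : ‖b‖ ≤ 1) (hd : ‖d‖ ≤ 1) :
    ‖(1 - (‖a‖ : ℂ) ^ 2) * ((1 - (‖b‖ : ℂ) ^ 2) * d - starRingEnd ℂ a * b ^ 2)
      + μ * (a * ((1 - (‖a‖ : ℂ) ^ 2) * b)) + ν * a ^ 3‖ ≤ M := by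
  -- Rotation makes `a` real: with `b = β ζ ^ 2`, every term without `d` carries the factor `ζ ^ 3`,
  -- and `d` enters only through its norm.
  obtain ⟨ζ, hζ, haζ⟩ : ∃ ζ : ℂ, ‖ζ‖ = 1 ∧ a = ‖a‖ * ζ := by
    rcases eq_or_ne a 0 with rfl | h
    · exact ⟨1, by simp, by simp⟩
    · have : (‖a‖ : ℂ) ≠ 0 := by simpa using h
      exact ⟨a / ‖a‖, by simp [h], by field_simp⟩
  set x : ℝ := ‖a‖ with hx
  have hcζ : starRingEnd ℂ ζ * ζ = 1 := by
    rw [← Complex.normSq_eq_conj_mul_self, Complex.normSq_eq_norm_sq, hζ]; norm_num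
  set β : ℂ := b * starRingEnd ℂ ζ ^ 2 with hβ
  have hbβ : b = β * ζ ^ 2 := by
    rw [hβ, mul_assoc, ← mul_pow, hcζ]; ring
  have hnβ : ‖β‖ = ‖b‖ := by simp [hβ, hζ]
  have hx0 : 0 ≤ x := norm_nonneg a
  set y : ℝ := ‖b‖ with hy
  have hy0 : 0 ≤ y := norm_nonneg b
  set V : ℂ := (1 - (x : ℂ) ^ 2) * (μ * β - β ^ 2) + ν * (x : ℂ) ^ 2 with hV
  have key : (1 - (x : ℂ) ^ 2) * ((1 - (y : ℂ) ^ 2) * d - starRingEnd ℂ a * b ^ 2)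
      + μ * (a * ((1 - (x : ℂ) ^ 2) * b)) + ν * a ^ 3
      = (((1 - x ^ 2) * (1 - y ^ 2) : ℝ) : ℂ) * d + ζ ^ 3 * ((x : ℂ) * V) := by
    have h1 : starRingEnd ℂ a = x * starRingEnd ℂ ζ := by
      conv_lhs => rw [haζ]
      simp
    rw [h1, hbβ, hV]
    conv_lhs => rw [haζ]
    push_cast
    linear_combination (-(1 - (x : ℂ) ^ 2) * x * β ^ 2 * ζ ^ 3) * hcζ
  rw [key]
  have hp : 0 ≤ (1 - x ^ 2) * (1 - y ^ 2) := by
    apply mul_nonneg <;> nlinarith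
  have hV2 : ‖V‖ ^ 2 = (1 - x ^ 2) ^ 2 * y ^ 2 * (μ ^ 2 + y ^ 2)
        - 2 * μ * (1 - x ^ 2) ^ 2 * y ^ 2 * β.re
        + 2 * (1 - x ^ 2) * ν * x ^ 2 * (μ * β.re - 2 * β.re ^ 2 + y ^ 2)
        + ν ^ 2 * (x ^ 2) ^ 2 := by
    have h2 : y ^ 2 = β.re ^ 2 + β.im ^ 2 := by
      rw [← hnβ, ← Complex.normSq_eq_norm_sq, Complex.normSq_apply]; ring
    have hVe : V = ((((1 - x ^ 2) * (μ * β.re - (β.re ^ 2 - β.im ^ 2)) + ν * x ^ 2 : ℝ) : ℂ) +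
        (((1 - x ^ 2) * (μ * β.im - 2 * β.re * β.im) : ℝ) : ℂ) * Complex.I) := by
      rw [hV]
      conv_lhs => rw [← Complex.re_add_im β]
      push_cast
      linear_combination (-(1 - (x : ℂ) ^ 2) * β.im ^ 2) * Complex.I_sq
    rw [hVe, ← Complex.normSq_eq_norm_sq, Complex.normSq_add_mul_I, h2]
    ring
  have hk : -y ≤ β.re := by
    rw [← hnβ]; exact (abs_le.1 (Complex.abs_re_le_norm β)).1
  have hmain := schur_bound_real hμ hν hM hμν hA hB hx0 ha hy0 hb hk (norm_nonneg V) hV2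
  calc _ ≤ ‖(((1 - x ^ 2) * (1 - y ^ 2) : ℝ) : ℂ) * d‖ + ‖ζ ^ 3 * ((x : ℂ) * V)‖ :=
        norm_add_le _ _
    _ = (1 - x ^ 2) * (1 - y ^ 2) * ‖d‖ + x * ‖V‖ := by
        rw [norm_mul, norm_mul, norm_mul, norm_pow, hζ, Complex.norm_real, Complex.norm_real,
          Real.norm_of_nonneg hp, Real.norm_of_nonneg hx0]
        ring
    _ ≤ (1 - x ^ 2) * (1 - y ^ 2) + x * ‖V‖ := by
        have := mul_le_of_le_one_right hp hd
        linarith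
    _ ≤ M := hmain

/-- The one-variable maximum behind the bound for small first coefficients. -/
theorem schur_extremal_small {μ ν r x y : ℝ} (hμ : 0 < μ) (hν : 0 < ν) (hr : 0 ≤ r)
    (hr2 : 3 * r ^ 2 * (μ + 1 + ν) = μ + 1) (hx0 : 0 ≤ x) (hx1 : x ≤ 1) (hy1 : y ≤ 1)
    (hsmall : x ≤ 2 / (μ + 2) →
      1 + x ^ 2 * (μ ^ 2 / 4 - 1) + x ^ 3 * (μ ^ 2 / 4 - ν) ≤ 2 / 3 * (μ + 1) * r) :
    (1 - x ^ 2) * (1 - y ^ 2) + x * ((1 - x ^ 2) * (μ * y + y ^ 2) - ν * x ^ 2)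
      ≤ 2 / 3 * (μ + 1) * r := by
  have hs : 0 ≤ 1 - x ^ 2 := by nlinarith
  rcases le_total x (2 / (μ + 2)) with h | h
  · refine le_trans ?_ (hsmall h)
    -- The concave quadratic in `y` peaks at `y = μ x / (2 (1 - x))`, which is at most `1` exactly
    -- when `x ≤ 2 / (μ + 2)`, for `x < 1`.
    have h1 : 0 ≤ (1 + x) * (2 * (1 - x) * y - μ * x) ^ 2 := by positivity
    rcases eq_or_lt_of_le hx1 with rfl | hlt
    · nlinarith [sq_nonneg μ]
    · nlinarith
  · have h1 : 2 ≤ x * (μ + 2) := by rwa [div_le_iff₀ (by linarith)] at h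
    -- Now `y = 1` is optimal; this product is the value there minus the value at `y`. The remaining
    -- cubic in `x` has its maximum at `r`, a double root of the difference below.
    have h2 : 0 ≤ (1 - x ^ 2) * (1 - y) * (x * μ - (1 - x) * (1 + y)) := by
      refine mul_nonneg (mul_nonneg hs (by linarith)) ?_
      nlinarith
    have h3 : 0 ≤ (μ + 1 + ν) * ((x - r) ^ 2 * (x + 2 * r)) := by positivity
    have h4 : (μ + 1) * x - (μ + 1 + ν) * x ^ 3 ≤ 2 / 3 * (μ + 1) * r := by
      have e : 2 / 3 * (μ + 1) * r - ((μ + 1) * x - (μ + 1 + ν) * x ^ 3)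
          = (μ + 1 + ν) * ((x - r) ^ 2 * (x + 2 * r)) := by
        linear_combination (x - 2 / 3 * r) * hr2
      linarith
    nlinarith

/-- The bound is `(2/3)(μ + 1) r` for `μ = 13/6`, `ν = 25/24`, with `r` the critical point of the
cubic: `r ^ 2 = (μ + 1) / (3 (μ + 1 + ν)) = 76/303`. -/
theorem schur_bound_thirteen_sixths {a b d : ℂ} (ha : ‖a‖ ≤ 1) (hb : ‖b‖ ≤ 1) (hd : ‖d‖ ≤ 1) :
    ‖(1 - (‖a‖ : ℂ) ^ 2) * ((1 - (‖b‖ : ℂ) ^ 2) * d - starRingEnd ℂ a * b ^ 2)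
      + (13 / 6 : ℝ) * (a * ((1 - (‖a‖ : ℂ) ^ 2) * b)) + (25 / 24 : ℝ) * a ^ 3‖
      ≤ 19 / 9 * Real.sqrt (76 / 303) := by
  set r := Real.sqrt (76 / 303) with hr
  have hr0 : 0 ≤ r := Real.sqrt_nonneg _
  have hr2 : r ^ 2 = 76 / 303 := Real.sq_sqrt (by norm_num)
  have hrl : (1001 / 2000 : ℝ) ≤ r := Real.le_sqrt_of_sq_le (by norm_num)
  refine schur_bound_complex (by norm_num) (by norm_num) (by linarith) (by norm_num) ?_ ?_
    ha hb hd
  · intro x y hx0 hx1 hy0 hy1 hx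
    -- Here `ν > 1`, so `ν x ≤ 1` depends on the threshold for `x ^ 2`.
    refine ⟨by nlinarith, ?_⟩
    have := schur_extremal_small (μ := 13 / 6) (ν := 25 / 24) (r := r) (by norm_num) (by norm_num)
      hr0 (by rw [hr2]; norm_num) hx0 hx1 hy1 (fun h => ?_)
    · linarith
    -- Both powers of `x` have positive coefficients, so the endpoint `2 / (μ + 2) = 12/25` is the
    -- worst case.
    · have h' : x ≤ 12 / 25 := by norm_num at h; exact h
      have h2 : x ^ 2 ≤ (12 / 25) ^ 2 := by gcongr
      have h3 : x ^ 3 ≤ (12 / 25) ^ 3 := by gcongr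
      linarith
  · intro X hX1 hX
    rw [mul_pow, hr2]
    -- `312/1237` is the threshold `μ / (μ + ν (4 + μ))`. The inequality is nearly tight there, but
    -- right side minus left side has positive coefficients in `T`.
    obtain ⟨T, rfl⟩ : ∃ T, X = 312 / 1237 + T := ⟨X - 312 / 1237, by ring⟩
    have hT : 0 ≤ T := by linarith
    have hT2 : 0 ≤ T ^ 2 := by positivity
    have hT3 : 0 ≤ T ^ 3 := by positivity
    linarith

theorem schur_bound_twentythree_tenths {a b d : ℂ} (ha : ‖a‖ ≤ 1) (hb : ‖b‖ ≤ 1)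
    (hd : ‖d‖ ≤ 1) :
    ‖(1 - (‖a‖ : ℂ) ^ 2) * ((1 - (‖b‖ : ℂ) ^ 2) * d - starRingEnd ℂ a * b ^ 2)
      + (23 / 10 : ℝ) * (a * ((1 - (‖a‖ : ℂ) ^ 2) * b)) + (17 / 20 : ℝ) * a ^ 3‖
      ≤ 11 / 5 * Real.sqrt (22 / 83) := by
  set r := Real.sqrt (22 / 83) with hr
  have hr0 : 0 ≤ r := Real.sqrt_nonneg _
  have hr2 : r ^ 2 = 22 / 83 := Real.sq_sqrt (by norm_num)
  have hrl : (514 / 1000 : ℝ) ≤ r := Real.le_sqrt_of_sq_le (by norm_num)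
  refine schur_bound_complex (by norm_num) (by norm_num) (by linarith) (by norm_num) ?_ ?_
    ha hb hd
  · intro x y hx0 hx1 hy0 hy1 hx
    refine ⟨by linarith, ?_⟩
    have := schur_extremal_small (μ := 23 / 10) (ν := 17 / 20) (r := r) (by norm_num)
      (by norm_num) hr0 (by rw [hr2]; norm_num) hx0 hx1 hy1 (fun h => ?_)
    · linarith
    · have h' : x ≤ 20 / 43 := by norm_num at h; exact h
      have h2 : x ^ 2 ≤ (20 / 43) ^ 2 := by gcongr
      have h3 : x ^ 3 ≤ (20 / 43) ^ 3 := by gcongr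
      linarith
  · intro X hX1 hX
    rw [mul_pow, hr2]
    nlinarith

/-! ### Taylor series at the origin as formal power series. -/

/-- The Taylor series at `0` as a formal power series. -/
noncomputable def taylorPS (f : ℂ → ℂ) : PowerSeries ℂ :=
  PowerSeries.mk fun n => iteratedDeriv n f 0 / (n.factorial : ℂ)

theorem coeff_taylorPS (f : ℂ → ℂ) (n : ℕ) :
    PowerSeries.coeff n (taylorPS f) = iteratedDeriv n f 0 / (n.factorial : ℂ) :=
  PowerSeries.coeff_mk _ _

theorem coeff_zero_taylorPS (f : ℂ → ℂ) : PowerSeries.coeff 0 (taylorPS f) = f 0 := by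
  simp [coeff_taylorPS]

theorem taylorPS_congr {f g : ℂ → ℂ} (h : f =ᶠ[nhds 0] g) : taylorPS f = taylorPS g := by
  ext n
  rw [coeff_taylorPS, coeff_taylorPS, h.iteratedDeriv_eq n]

theorem taylorPS_mul {f g : ℂ → ℂ} (hf : AnalyticAt ℂ f 0) (hg : AnalyticAt ℂ g 0) :
    taylorPS (fun z => f z * g z) = taylorPS f * taylorPS g := by
  ext n
  rw [PowerSeries.coeff_mul, Finset.Nat.sum_antidiagonal_eq_sum_range_succ_mk, coeff_taylorPS,
    iteratedDeriv_fun_mul hf.contDiffAt hg.contDiffAt, Finset.sum_div]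
  refine Finset.sum_congr rfl fun i hi => ?_
  rw [coeff_taylorPS, coeff_taylorPS,
    Nat.cast_choose ℂ (Nat.lt_succ_iff.1 (Finset.mem_range.1 hi))]
  have h1 : (n.factorial : ℂ) ≠ 0 := by exact_mod_cast n.factorial_ne_zero
  field_simp

theorem taylorPS_add {f g : ℂ → ℂ} (hf : AnalyticAt ℂ f 0) (hg : AnalyticAt ℂ g 0) :
    taylorPS (fun z => f z + g z) = taylorPS f + taylorPS g := by
  ext n
  rw [map_add, coeff_taylorPS, coeff_taylorPS, coeff_taylorPS,
    iteratedDeriv_fun_add hf.contDiffAt hg.contDiffAt, add_div]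

theorem taylorPS_const (c : ℂ) : taylorPS (fun _ => c) = PowerSeries.C c := by
  ext n
  rw [coeff_taylorPS, iteratedDeriv_const, PowerSeries.coeff_C]
  split_ifs with h <;> simp [h]

theorem taylorPS_id : taylorPS (fun z => z) = PowerSeries.X := by
  ext n
  rw [coeff_taylorPS, iteratedDeriv_fun_id_zero, PowerSeries.coeff_X]
  split_ifs with h <;> simp [h]

theorem coeff_taylorPS_deriv (f : ℂ → ℂ) (n : ℕ) :
    PowerSeries.coeff n (taylorPS (deriv f))
      = (n + 1) * PowerSeries.coeff (n + 1) (taylorPS f) := by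
  have h1 : (n.factorial : ℂ) ≠ 0 := by exact_mod_cast n.factorial_ne_zero
  have h2 : ((n : ℂ) + 1) ≠ 0 := by exact_mod_cast n.succ_ne_zero
  rw [coeff_taylorPS, coeff_taylorPS, iteratedDeriv_succ', Nat.factorial_succ]
  push_cast
  field_simp

/-! ### The Schur algorithm. -/

/-- One step of the Schur algorithm. -/
theorem exists_schur_step {f : ℂ → ℂ} (hf : DifferentiableOn ℂ f (Metric.ball 0 1))
    (hb : ∀ z ∈ Metric.ball (0 : ℂ) 1, ‖f z‖ ≤ 1) :
    ∃ g : ℂ → ℂ, DifferentiableOn ℂ g (Metric.ball 0 1) ∧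
      (∀ z ∈ Metric.ball (0 : ℂ) 1, ‖g z‖ ≤ 1) ∧
      ∀ z ∈ Metric.ball (0 : ℂ) 1, f z + f z * (starRingEnd ℂ (f 0) * (z * g z))
        = f 0 + z * g z := by
  have h0mem : (0 : ℂ) ∈ Metric.ball (0 : ℂ) 1 := Metric.mem_ball_self one_pos
  have hball : Metric.ball (0 : ℂ) 1 ∈ nhds 0 := Metric.ball_mem_nhds 0 one_pos
  rcases eq_or_lt_of_le (hb 0 h0mem) with h1 | h1
  -- If `|f(0)| = 1`, the maximum principle makes `f` constant, and `g = 0` serves.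
  · refine ⟨fun _ => 0, differentiableOn_const _, by simp, fun z hz => ?_⟩
    have := Complex.eqOn_of_isPreconnected_of_isMaxOn_norm
      (convex_ball (0 : ℂ) 1).isPreconnected Metric.isOpen_ball hf h0mem
      (fun w hw => by simpa [h1] using hb w hw) hz
    simpa using this
  · set a := f 0 with ha
    have hden : ∀ w : ℂ, ‖w‖ ≤ 1 → 1 - starRingEnd ℂ a * w ≠ 0 := by
      intro w hw h
      have h2 : ‖starRingEnd ℂ a * w‖ = 1 := by rw [← sub_eq_zero.1 h]; simp
      rw [norm_mul, RCLike.norm_conj] at h2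
      nlinarith [norm_nonneg a, norm_nonneg w]
    set h : ℂ → ℂ := fun z => (f z - a) / (1 - starRingEnd ℂ a * f z) with hh
    have hd : DifferentiableOn ℂ h (Metric.ball 0 1) :=
      (hf.sub_const a).div ((hf.const_mul _).const_sub 1) fun z hz => hden _ (hb z hz)
    have hh0 : h 0 = 0 := by simp [hh, ha]
    have hmaps : Set.MapsTo h (Metric.ball 0 1) (Metric.closedBall (h 0) 1) := by
      intro z hz
      rw [hh0, mem_closedBall_zero_iff, hh, norm_div, div_le_one (norm_pos_iff.2 (hden _ (hb z hz)))]
      refine (abs_le_of_sq_le_sq' ?_ (norm_nonneg _)).2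
      have h3 := hb z hz
      -- This product equals `|1 - ā w|² - |w - a|²` at `w = f z`.
      have h4 : 0 ≤ (1 - ‖a‖ ^ 2) * (1 - ‖f z‖ ^ 2) := by
        apply mul_nonneg <;> nlinarith [norm_nonneg a, norm_nonneg (f z)]
      rw [← Complex.normSq_eq_norm_sq, ← Complex.normSq_eq_norm_sq, Complex.normSq_apply,
        Complex.normSq_apply] at *
      simp only [Complex.sub_re, Complex.sub_im, Complex.mul_re, Complex.mul_im, Complex.conj_re,
        Complex.conj_im, Complex.one_re, Complex.one_im]
      nlinarith
    refine ⟨dslope h 0, (Complex.differentiableOn_dslope hball).2 hd, fun z hz => by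
      simpa using Complex.norm_dslope_le_div_of_mapsTo_ball hd hmaps hz, fun z hz => ?_⟩
    have h5 : z * dslope h 0 z = h z := by
      have := sub_smul_dslope h 0 z
      simpa [hh0] using this
    have h6 : h z * (1 - starRingEnd ℂ a * f z) = f z - a := div_mul_cancel₀ _ (hden _ (hb z hz))
    rw [h5]
    linear_combination -h6

/-- The first three coefficients of a function bounded by `1` in terms of Schur parameters. -/
theorem exists_schur_parameters {f : ℂ → ℂ} (hf : DifferentiableOn ℂ f (Metric.ball 0 1))
    (hb : ∀ z ∈ Metric.ball (0 : ℂ) 1, ‖f z‖ ≤ 1) :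
    ∃ a b d : ℂ, ‖a‖ ≤ 1 ∧ ‖b‖ ≤ 1 ∧ ‖d‖ ≤ 1 ∧
      PowerSeries.coeff 0 (taylorPS f) = a ∧
      PowerSeries.coeff 1 (taylorPS f) = (1 - (‖a‖ : ℂ) ^ 2) * b ∧
      PowerSeries.coeff 2 (taylorPS f) =
        (1 - (‖a‖ : ℂ) ^ 2) * ((1 - (‖b‖ : ℂ) ^ 2) * d - starRingEnd ℂ a * b ^ 2) := by
  have h0mem : (0 : ℂ) ∈ Metric.ball (0 : ℂ) 1 := Metric.mem_ball_self one_pos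
  have hball : Metric.ball (0 : ℂ) 1 ∈ nhds 0 := Metric.ball_mem_nhds 0 one_pos
  have hps : ∀ {f g : ℂ → ℂ}, DifferentiableOn ℂ f (Metric.ball 0 1) →
      DifferentiableOn ℂ g (Metric.ball 0 1) →
      (∀ z ∈ Metric.ball (0 : ℂ) 1, f z + f z * (starRingEnd ℂ (f 0) * (z * g z))
        = f 0 + z * g z) →
      taylorPS f + taylorPS f * (PowerSeries.C (starRingEnd ℂ (f 0)) *
        (PowerSeries.X * taylorPS g)) = PowerSeries.C (f 0) + PowerSeries.X * taylorPS g := by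
    intro f g hf hg h
    have hfa := hf.analyticAt hball
    have hga := hg.analyticAt hball
    have e := taylorPS_congr (Filter.eventually_of_mem hball h)
    have hz : AnalyticAt ℂ (fun z : ℂ => z) 0 := analyticAt_id
    have hzg : AnalyticAt ℂ (fun z : ℂ => z * g z) 0 := hz.mul hga
    have hczg : AnalyticAt ℂ (fun z : ℂ => starRingEnd ℂ (f 0) * (z * g z)) 0 :=
      analyticAt_const.mul hzg
    have hfc : AnalyticAt ℂ (fun z : ℂ => f z * (starRingEnd ℂ (f 0) * (z * g z))) 0 :=
      hfa.mul hczg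
    rwa [taylorPS_add hfa hfc, taylorPS_mul hfa hczg, taylorPS_mul analyticAt_const hzg,
      taylorPS_add analyticAt_const hzg, taylorPS_const, taylorPS_const, taylorPS_mul hz hga,
      taylorPS_id] at e
  obtain ⟨g, hg, hgb, hfg⟩ := exists_schur_step hf hb
  obtain ⟨k, hk, hkb, hgk⟩ := exists_schur_step hg hgb
  have e1 := hps hf hg hfg
  have e2 := hps hg hk hgk
  have c1 := fun n => congrArg (PowerSeries.coeff n) e1
  have c2 := congrArg (PowerSeries.coeff 1) e2
  have c11 := c1 1
  have c12 := c1 2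
  have hsq : ∀ w : ℂ, starRingEnd ℂ w * w = (‖w‖ : ℂ) ^ 2 := fun w => by
    rw [← Complex.normSq_eq_conj_mul_self, Complex.normSq_eq_norm_sq]; push_cast; rfl
  simp [PowerSeries.coeff_mul, Finset.Nat.antidiagonal_succ, PowerSeries.coeff_X,
    PowerSeries.coeff_C, coeff_zero_taylorPS, -PowerSeries.coeff_zero_eq_constantCoeff] at c2 c11 c12
  refine ⟨f 0, g 0, k 0, hb 0 h0mem, hgb 0 h0mem, hkb 0 h0mem, coeff_zero_taylorPS f, ?_, ?_⟩
  · rw [← hsq]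
    linear_combination c11
  · rw [← hsq, ← hsq]
    linear_combination c12 - starRingEnd ℂ (f 0) * g 0 * c11
      + (1 - starRingEnd ℂ (f 0) * f 0) * c2

/-! ### Carathéodory functions: coefficient bounds and parameters. -/

/-- **Carathéodory's coefficient bound.** -/
theorem norm_coeff_le_two_of_re_pos {p : ℂ → ℂ} (hp : DifferentiableOn ℂ p (Metric.ball 0 1))
    (hp0 : p 0 = 1) (hre : ∀ z ∈ Metric.ball (0 : ℂ) 1, 0 < (p z).re) {n : ℕ} (hn : n ≠ 0) :
    ‖PowerSeries.coeff n (taylorPS p)‖ ≤ 2 := by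
  have hbound : ∀ r : ℝ, 0 < r → r < 1 → r ^ n * ‖PowerSeries.coeff n (taylorPS p)‖ ≤ 2 := by
    intro r hr0 hr1
    have hsub : Metric.closedBall (0 : ℂ) r ⊆ Metric.ball 0 1 := Metric.closedBall_subset_ball hr1
    have hpr : DiffContOnCl ℂ p (Metric.ball 0 r) := hp.diffContOnCl_ball hsub
    have hsph : Metric.sphere (0 : ℂ) r ⊆ Metric.ball 0 1 :=
      Metric.sphere_subset_closedBall.trans hsub
    have hpc : ContinuousOn p (Metric.sphere 0 r) := hp.continuousOn.mono hsph
    have hne : ∀ z ∈ Metric.sphere (0 : ℂ) r, z ≠ 0 := fun z hz => ne_zero_of_mem_sphere hr0.ne' ⟨z, hz⟩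
    have hci : ∀ {F : ℂ → ℂ}, ContinuousOn F (Metric.sphere 0 r) → CircleIntegrable F 0 r :=
      fun h => h.circleIntegrable hr0.le
    -- Cauchy's formula for the coefficient
    have h1 : Real.circleAverage (fun z => (z ^ n)⁻¹ * p z) 0 r
        = PowerSeries.coeff n (taylorPS p) := by
      have h2 := hpr.circleIntegral_one_div_sub_center_pow_smul hr0 n
      rw [Real.circleAverage_eq_circleIntegral hr0.ne', coeff_taylorPS]
      have h3 : (∮ z in C(0, r), (z - 0)⁻¹ • ((z ^ n)⁻¹ * p z)) =
          ∮ z in C(0, r), (1 / (z - 0) ^ (n + 1)) • p z := by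
        refine circleIntegral.integral_congr hr0.le fun z hz => ?_
        simp only [smul_eq_mul, sub_zero, one_div, pow_succ, mul_inv]
        ring
      rw [h3, h2, smul_smul, smul_eq_mul]
      have := Complex.two_pi_I_ne_zero
      field_simp
    -- the mean value property for `z ^ n * p z`
    have h4 : Real.circleAverage (fun z => z ^ n * p z) 0 r = 0 := by
      have : DiffContOnCl ℂ (fun z => z ^ n * p z) (Metric.ball 0 |r|) := by
        rw [abs_of_pos hr0]
        exact ((differentiable_id.pow n).diffContOnCl).smul hpr
      rw [this.circleAverage]
      simp [hn]
    have hinv : ∀ z ∈ Metric.sphere (0 : ℂ) r, (z ^ n)⁻¹ * ((r : ℂ) ^ (2 * n))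
        = starRingEnd ℂ (z ^ n) := by
      intro z hz
      have hz0 := hne z hz
      have : (r : ℂ) ^ 2 = starRingEnd ℂ z * z := by
        rw [← Complex.normSq_eq_conj_mul_self, Complex.normSq_eq_norm_sq,
          mem_sphere_zero_iff_norm.1 hz]
        push_cast; rfl
      rw [pow_mul, this, mul_pow, map_pow]
      field_simp
    have hic : ContinuousOn (fun z : ℂ => (z ^ n)⁻¹) (Metric.sphere 0 r) :=
      ((continuous_pow n).continuousOn).inv₀ fun z hz => pow_ne_zero _ (hne z hz)
    -- On `|z| = r`, `z⁻ⁿ` is a multiple of the conjugate of `zⁿ`, so this is a multiple of the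
    -- conjugate of the vanishing mean of `zⁿ p`. Adding it replaces `p` by `2 Re p` in Cauchy's
    -- formula.
    have h5 : Real.circleAverage (fun z => (z ^ n)⁻¹ * starRingEnd ℂ (p z)) 0 r = 0 := by
      have e : Real.circleAverage (fun z => (z ^ n)⁻¹ * starRingEnd ℂ (p z)) 0 r =
          ((r : ℂ) ^ (2 * n))⁻¹ • Real.circleAverage
            ((Complex.conjCLE : ℂ →L[ℝ] ℂ) ∘ fun z => z ^ n * p z) 0 r := by
        rw [← Real.circleAverage_fun_smul]
        refine Real.circleAverage_congr_sphere fun z hz => ?_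
        rw [abs_of_pos hr0] at hz
        have hr' : (r : ℂ) ^ (2 * n) ≠ 0 := pow_ne_zero _ (by exact_mod_cast hr0.ne')
        simp only [Function.comp_apply, smul_eq_mul, ContinuousLinearEquiv.coe_coe,
          Complex.conjCLE_apply, map_mul, ← hinv z hz]
        field_simp
      rw [e, ContinuousLinearMap.circleAverage_comp_comm _
        (hci (show ContinuousOn (fun z : ℂ => z ^ n * p z) _ from
          (continuous_pow n).continuousOn.mul hpc)), h4]
      simp
    have hcc : ContinuousOn (fun z => starRingEnd ℂ (p z)) (Metric.sphere 0 r) :=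
      Complex.continuous_conj.comp_continuousOn hpc
    have h6 : PowerSeries.coeff n (taylorPS p) =
        Real.circleAverage (fun z => (z ^ n)⁻¹ * (2 * ((p z).re : ℂ))) 0 r := by
      have e := (Real.circleAverage_fun_add (hci (hic.mul hpc)) (hci (hic.mul hcc))).trans
        (congrArg₂ (· + ·) h1 h5)
      simp only [Pi.mul_apply, add_zero] at e
      rw [← e]
      refine Real.circleAverage_congr_sphere fun z hz => ?_
      simp only [← mul_add, Complex.add_conj]
      push_cast; rfl
    have hrec : ContinuousOn (fun z => (p z).re) (Metric.sphere 0 r) :=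
      Complex.continuous_re.comp_continuousOn hpc
    have h7 : Real.circleAverage (fun z => (p z).re) 0 r = 1 := by
      have e := ContinuousLinearMap.circleAverage_comp_comm Complex.reCLM (hci hpc)
      have e2 : Real.circleAverage p 0 r = p 0 := by
        refine DiffContOnCl.circleAverage ?_
        rwa [abs_of_pos hr0]
      rw [e2, hp0] at e
      exact e
    -- Positivity lets `|Re p|` be replaced by `Re p`, whose mean is `1`.
    have h8 : ‖PowerSeries.coeff n (taylorPS p)‖ ≤
        Real.circleAverage (fun z => (2 * (r ^ n)⁻¹) • (p z).re) 0 r := by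
      rw [h6, Real.circleAverage_def, Real.circleAverage_def, norm_smul, smul_eq_mul,
        Real.norm_of_nonneg (by positivity)]
      refine mul_le_mul_of_nonneg_left ?_ (by positivity)
      refine (intervalIntegral.norm_integral_le_integral_norm (by positivity)).trans_eq ?_
      refine intervalIntegral.integral_congr fun θ _ => ?_
      have hz : circleMap 0 r θ ∈ Metric.sphere (0 : ℂ) r := circleMap_mem_sphere 0 hr0.le θ
      have := (hre _ (hsph hz)).le
      simp only [norm_mul, norm_inv, norm_pow, mem_sphere_zero_iff_norm.1 hz, Complex.norm_real,
        Real.norm_of_nonneg this, smul_eq_mul, Complex.norm_ofNat]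
      ring
    rw [Real.circleAverage_fun_smul, h7, smul_eq_mul, mul_one] at h8
    have hrn : 0 < r ^ n := by positivity
    calc r ^ n * _ ≤ r ^ n * (2 * (r ^ n)⁻¹) := by gcongr
      _ = 2 := by field_simp
  have ht : Filter.Tendsto (fun r : ℝ => r ^ n * ‖PowerSeries.coeff n (taylorPS p)‖)
      (nhdsWithin 1 (Set.Iio 1)) (nhds (1 ^ n * ‖PowerSeries.coeff n (taylorPS p)‖)) := by
    refine Filter.Tendsto.mono_left ?_ nhdsWithin_le_nhds
    exact (by fun_prop : Continuous fun r : ℝ =>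
      r ^ n * ‖PowerSeries.coeff n (taylorPS p)‖).tendsto 1
  rw [one_pow, one_mul] at ht
  refine le_of_tendsto ht ?_
  filter_upwards [Ioo_mem_nhdsLT (zero_lt_one' ℝ)] with r hr using hbound r hr.1 hr.2

/-- A function with positive real part is a Cayley transform of `z φ(z)` with `|φ| ≤ 1`. -/
theorem exists_bounded_of_re_pos {p : ℂ → ℂ} (hp : DifferentiableOn ℂ p (Metric.ball 0 1))
    (hp0 : p 0 = 1) (hre : ∀ z ∈ Metric.ball (0 : ℂ) 1, 0 < (p z).re) :
    ∃ φ : ℂ → ℂ, DifferentiableOn ℂ φ (Metric.ball 0 1) ∧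
      (∀ z ∈ Metric.ball (0 : ℂ) 1, ‖φ z‖ ≤ 1) ∧
      ∀ z ∈ Metric.ball (0 : ℂ) 1, p z = 1 + z * (φ z * (p z + 1)) := by
  have hball : Metric.ball (0 : ℂ) 1 ∈ nhds 0 := Metric.ball_mem_nhds 0 one_pos
  have hden : ∀ z ∈ Metric.ball (0 : ℂ) 1, p z + 1 ≠ 0 := by
    intro z hz h
    have h1 := congrArg Complex.re h
    simp only [Complex.add_re, Complex.one_re, Complex.zero_re] at h1
    linarith [hre z hz]
  set h : ℂ → ℂ := fun z => (p z - 1) / (p z + 1) with hh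
  have hd : DifferentiableOn ℂ h (Metric.ball 0 1) := (hp.sub_const 1).div (hp.add_const 1) hden
  have hh0 : h 0 = 0 := by simp [hh, hp0]
  have hmaps : Set.MapsTo h (Metric.ball 0 1) (Metric.closedBall (h 0) 1) := by
    intro z hz
    rw [hh0, mem_closedBall_zero_iff, hh, norm_div, div_le_one (norm_pos_iff.2 (hden z hz))]
    refine (abs_le_of_sq_le_sq' ?_ (norm_nonneg _)).2
    rw [← Complex.normSq_eq_norm_sq, ← Complex.normSq_eq_norm_sq, Complex.normSq_apply,
      Complex.normSq_apply]
    simp only [Complex.sub_re, Complex.sub_im, Complex.add_re, Complex.add_im, Complex.one_re,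
      Complex.one_im]
    linarith [hre z hz]
  refine ⟨dslope h 0, (Complex.differentiableOn_dslope hball).2 hd, fun z hz => by
    simpa using Complex.norm_dslope_le_div_of_mapsTo_ball hd hmaps hz, fun z hz => ?_⟩
  have h5 : z * dslope h 0 z = h z := by
    have := sub_smul_dslope h 0 z
    simpa [hh0] using this
  have h6 : h z * (p z + 1) = p z - 1 := div_mul_cancel₀ _ (hden z hz)
  rw [← mul_assoc, h5]
  linear_combination -h6

/-- The first three Carathéodory coefficients in terms of Schur parameters. -/
theorem exists_caratheodory_parameters {p : ℂ → ℂ}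
    (hp : DifferentiableOn ℂ p (Metric.ball 0 1)) (hp0 : p 0 = 1)
    (hre : ∀ z ∈ Metric.ball (0 : ℂ) 1, 0 < (p z).re) :
    ∃ a b d : ℂ, ‖a‖ ≤ 1 ∧ ‖b‖ ≤ 1 ∧ ‖d‖ ≤ 1 ∧ ∃ c₂ c₃ : ℂ,
      c₂ = (1 - (‖a‖ : ℂ) ^ 2) * b ∧
      c₃ = (1 - (‖a‖ : ℂ) ^ 2) * ((1 - (‖b‖ : ℂ) ^ 2) * d - starRingEnd ℂ a * b ^ 2) ∧
      PowerSeries.coeff 1 (taylorPS p) = 2 * a ∧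
      PowerSeries.coeff 2 (taylorPS p) = 2 * (c₂ + a ^ 2) ∧
      PowerSeries.coeff 3 (taylorPS p) = 2 * (c₃ + 2 * a * c₂ + a ^ 3) := by
  have hball : Metric.ball (0 : ℂ) 1 ∈ nhds 0 := Metric.ball_mem_nhds 0 one_pos
  obtain ⟨φ, hφ, hφb, hpφ⟩ := exists_bounded_of_re_pos hp hp0 hre
  obtain ⟨a, b, d, ha, hb, hd, h1, h2, h3⟩ := exists_schur_parameters hφ hφb
  refine ⟨a, b, d, ha, hb, hd, _, _, rfl, rfl, ?_⟩
  rw [← h3, ← h2]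
  have hpa := hp.analyticAt hball
  have hφa := hφ.analyticAt hball
  have hid : AnalyticAt ℂ (fun z : ℂ => z) 0 := analyticAt_id
  have hp1 : AnalyticAt ℂ (fun z => p z + 1) 0 := hpa.add analyticAt_const
  have hm : AnalyticAt ℂ (fun z => φ z * (p z + 1)) 0 := hφa.mul hp1
  have hzm : AnalyticAt ℂ (fun z => z * (φ z * (p z + 1))) 0 := hid.mul hm
  have e := taylorPS_congr (Filter.eventually_of_mem hball hpφ)
  rw [taylorPS_add analyticAt_const hzm, taylorPS_mul hid hm, taylorPS_mul hφa hp1,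
    taylorPS_add hpa analyticAt_const, taylorPS_const, taylorPS_id] at e
  have c := fun n => congrArg (PowerSeries.coeff n) e
  have c1 := c 1
  have c2 := c 2
  have c3 := c 3
  have hc0 : PowerSeries.coeff 0 (taylorPS p) = 1 := by rw [coeff_zero_taylorPS, hp0]
  simp [PowerSeries.coeff_mul, Finset.Nat.antidiagonal_succ, PowerSeries.coeff_X,
    PowerSeries.coeff_one, hc0, h1, -PowerSeries.coeff_zero_eq_constantCoeff] at c1 c2 c3
  refine ⟨?_, ?_, ?_⟩
  · linear_combination c1
  · linear_combination c2 + a * c1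
  · linear_combination c3 + a * c2 + (a ^ 2 + PowerSeries.coeff 1 (taylorPS φ)) * c1

/-- These are the brackets in `γ₄` and `γ₅`; termwise estimates would lose the gain from the
negative cubic term. In Schur parameters they become twice the functional with `(μ, ν) = (13/6,
25/24)` and `(23/10, 17/20)`. -/
theorem norm_caratheodory_third_le {p : ℂ → ℂ}
    (hp : DifferentiableOn ℂ p (Metric.ball 0 1)) (hp0 : p 0 = 1)
    (hre : ∀ z ∈ Metric.ball (0 : ℂ) 1, 0 < (p z).re) :
    ‖PowerSeries.coeff 3 (taylorPS p)
        + 1 / 12 * (PowerSeries.coeff 1 (taylorPS p) * PowerSeries.coeff 2 (taylorPS p))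
        - 1 / 32 * PowerSeries.coeff 1 (taylorPS p) ^ 3‖ ≤ 38 / 9 * Real.sqrt (76 / 303) ∧
    ‖PowerSeries.coeff 3 (taylorPS p)
        + 3 / 20 * (PowerSeries.coeff 1 (taylorPS p) * PowerSeries.coeff 2 (taylorPS p))
        - 9 / 80 * PowerSeries.coeff 1 (taylorPS p) ^ 3‖ ≤ 22 / 5 * Real.sqrt (22 / 83) := by
  obtain ⟨a, b, d, ha, hb, hd, c₂, c₃, hc₂, hc₃, h1, h2, h3⟩ :=
    exists_caratheodory_parameters hp hp0 hre
  have b1 := schur_bound_thirteen_sixths ha hb hd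
  have b2 := schur_bound_twentythree_tenths ha hb hd
  rw [← hc₃, ← hc₂] at b1 b2
  rw [h1, h2, h3]
  constructor
  · have e : 2 * (c₃ + 2 * a * c₂ + a ^ 3) + 1 / 12 * (2 * a * (2 * (c₂ + a ^ 2)))
        - 1 / 32 * (2 * a) ^ 3
        = 2 * (c₃ + (13 / 6 : ℝ) * (a * c₂) + (25 / 24 : ℝ) * a ^ 3) := by
      push_cast; ring
    rw [e, norm_mul, Complex.norm_ofNat]
    linarith
  · have e : 2 * (c₃ + 2 * a * c₂ + a ^ 3) + 3 / 20 * (2 * a * (2 * (c₂ + a ^ 2)))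
        - 9 / 80 * (2 * a) ^ 3
        = 2 * (c₃ + (23 / 10 : ℝ) * (a * c₂) + (17 / 20 : ℝ) * a ^ 3) := by
      push_cast; ring
    rw [e, norm_mul, Complex.norm_ofNat]
    linarith

/-! ### Logarithmic coefficients of the class `ℱ(3)`. -/

/-- The function `1 + (2 / 3) z f''(z) / f'(z)`, which has positive real part for `f ∈ ℱ(3)`. -/
noncomputable def classFRe (f : ℂ → ℂ) (z : ℂ) : ℂ :=
  1 + 2 / 3 * (z * deriv (deriv f) z / deriv f z)

theorem classFRe_spec {f : ℂ → ℂ} (hf : f ∈ ClassF 3) :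
    DifferentiableOn ℂ (classFRe f) (Metric.ball 0 1) ∧ classFRe f 0 = 1 ∧
      ∀ z ∈ Metric.ball (0 : ℂ) 1, 0 < (classFRe f z).re := by
  obtain ⟨⟨hd, -, -⟩, h⟩ := hf
  have hd1 := hd.deriv Metric.isOpen_ball
  have hd2 := hd1.deriv Metric.isOpen_ball
  refine ⟨?_, by simp [classFRe], fun z hz => ?_⟩
  · exact (((differentiableOn_id.mul hd2).div hd1 fun z hz => (h z hz).1).const_mul
      (2 / 3 : ℂ)).const_add 1
  · have h1 := (h z hz).2
    have e : classFRe f z = 1 + ((2 / 3 : ℝ) : ℂ) * (z * deriv (deriv f) z / deriv f z) := by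
      rw [classFRe]; push_cast; rfl
    rw [e, Complex.add_re, Complex.re_ofReal_mul, Complex.one_re]
    rw [Complex.add_re, Complex.one_re] at h1
    linarith

/-- The differential equation between `q = z f' / f - 1` and `z f'' / f'`. -/
theorem eventually_briotBouquet {f : ℂ → ℂ} (hf : f ∈ ClassF 3) :
    ∃ q : ℂ → ℂ, AnalyticAt ℂ q 0 ∧ q 0 = 0 ∧
      (∀ n : ℕ, PowerSeries.coeff n (taylorPS q) = 2 * n * logCoeff f n) ∧
      ∀ᶠ z in nhds 0, (1 + q z) * (3 / 2 * (classFRe f z + -1))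
        = (1 + q z) * q z + z * deriv q z := by
  obtain ⟨⟨hd, hf0, hf1⟩, h⟩ := hf
  have hball : Metric.ball (0 : ℂ) 1 ∈ nhds 0 := Metric.ball_mem_nhds 0 one_pos
  have hid : AnalyticAt ℂ (fun z : ℂ => z) 0 := analyticAt_id
  have hq : AnalyticAt ℂ (dslope f 0) 0 :=
    ((Complex.differentiableOn_dslope hball).2 hd).analyticAt hball
  have hq1 : dslope f 0 0 = 1 := by rw [dslope_same, hf1]
  set g : ℂ → ℂ := fun z => Complex.log (dslope f 0 z) with hg
  have hga : AnalyticAt ℂ g 0 := hq.clog (by rw [hq1]; exact Complex.one_mem_slitPlane)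
  -- Writing `f = z e^g` and `q = z g'` gives `f' = e^g (1 + q)` and `z f''/f' = q + z q'/(1 + q)`;
  -- clearing denominators yields the equation.
  have hfg : f =ᶠ[nhds 0] fun z => z * Complex.exp (g z) := by
    have hne : ∀ᶠ z in nhds (0 : ℂ), dslope f 0 z ≠ 0 :=
      hq.continuousAt.eventually_ne (by rw [hq1]; exact one_ne_zero)
    filter_upwards [hne] with z hz
    rw [hg, Complex.exp_log hz]
    have := sub_smul_dslope f 0 z
    simpa [hf0] using this.symm
  set q : ℂ → ℂ := fun z => z * deriv g z with hqdef
  have hqa : AnalyticAt ℂ q 0 := hid.mul hga.deriv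
  have hfg1 : deriv f =ᶠ[nhds 0] fun z => Complex.exp (g z) * (1 + q z) := by
    refine hfg.deriv.trans ?_
    filter_upwards [hga.eventually_analyticAt] with z hz
    have h1 := (hasDerivAt_id z).mul hz.differentiableAt.hasDerivAt.cexp
    refine h1.deriv.trans ?_
    simp only [id, hqdef]
    ring
  have hfg2 : deriv (deriv f) =ᶠ[nhds 0]
      fun z => Complex.exp (g z) * (deriv g z * (1 + q z) + deriv q z) := by
    refine hfg1.deriv.trans ?_
    filter_upwards [hga.eventually_analyticAt, hqa.eventually_analyticAt] with z hz hqz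
    have h1 := hz.differentiableAt.hasDerivAt.cexp.mul
      (hqz.differentiableAt.hasDerivAt.const_add 1)
    refine h1.deriv.trans ?_
    ring
  refine ⟨q, hqa, by simp [hqdef], fun n => ?_, ?_⟩
  · rw [hqdef, taylorPS_mul hid hga.deriv, taylorPS_id]
    rcases n with _ | n
    · simp
    · have hfac : ((n + 1).factorial : ℂ) ≠ 0 := by exact_mod_cast (n + 1).factorial_ne_zero
      rw [mul_comm, PowerSeries.coeff_succ_mul_X, coeff_taylorPS_deriv, coeff_taylorPS, logCoeff,
        ← hg]
      push_cast
      field_simp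
  · filter_upwards [hball, hfg1, hfg2] with z hz h1 h2
    have hne := (h z hz).1
    have hu : 3 / 2 * (classFRe f z + -1) * deriv f z = z * deriv (deriv f) z := by
      rw [classFRe]
      field_simp
      ring
    rw [h1, h2] at hu
    refine mul_left_cancel₀ (Complex.exp_ne_zero (g z)) ?_
    have hqz : q z = z * deriv g z := rfl
    linear_combination hu - Complex.exp (g z) * (1 + q z) * hqz

/-- The logarithmic coefficients of `f ∈ ℱ(3)` in terms of Carathéodory coefficients. -/
theorem logCoeff_eq_caratheodory {f : ℂ → ℂ} (hf : f ∈ ClassF 3) {p : ℕ → ℂ}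
    (hp : ∀ n, p n = PowerSeries.coeff n (taylorPS (classFRe f))) :
    logCoeff f 1 = 3 / 8 * p 1 ∧
    logCoeff f 2 = 1 / 4 * (1 / 2 * p 2 + 3 / 16 * (p 1 * p 1)) ∧
    logCoeff f 3 = 1 / 6 * (3 / 8 * p 3 + 9 / 32 * (p 1 * p 2)) ∧
    logCoeff f 4 = 1 / 40 * (3 / 2 * p 4 + 1 / 2 * (p 2 * p 2)
      + 9 / 8 * (p 1 * (p 3 + 1 / 12 * (p 1 * p 2) - 1 / 32 * p 1 ^ 3))) ∧
    logCoeff f 5 = 1 / 60 * (3 / 2 * p 5 + 9 / 8 * (p 1 * p 4) + 9 / 64 * (p 1 * p 1 * p 3)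
      + 15 / 16 * (p 2 * (p 3 + 3 / 20 * (p 1 * p 2) - 9 / 80 * p 1 ^ 3))) := by
  obtain ⟨q, hqa, hq0, hqc, hev⟩ := eventually_briotBouquet hf
  obtain ⟨hd, hp0, -⟩ := classFRe_spec hf
  have hball : Metric.ball (0 : ℂ) 1 ∈ nhds 0 := Metric.ball_mem_nhds 0 one_pos
  have hpa := hd.analyticAt hball
  have hid : AnalyticAt ℂ (fun z : ℂ => z) 0 := analyticAt_id
  have h1q : AnalyticAt ℂ (fun z => 1 + q z) 0 := analyticAt_const.add hqa
  have hp1 : AnalyticAt ℂ (fun z => classFRe f z + -1) 0 := hpa.add analyticAt_const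
  have hu : AnalyticAt ℂ (fun z => 3 / 2 * (classFRe f z + -1)) 0 := analyticAt_const.mul hp1
  have hqq : AnalyticAt ℂ (fun z => (1 + q z) * q z) 0 := h1q.mul hqa
  have hzq : AnalyticAt ℂ (fun z => z * deriv q z) 0 := hid.mul hqa.deriv
  have e := taylorPS_congr hev
  rw [taylorPS_mul h1q hu, taylorPS_mul analyticAt_const hp1, taylorPS_add hqq hzq,
    taylorPS_mul h1q hqa, taylorPS_mul hid hqa.deriv, taylorPS_add analyticAt_const hqa,
    taylorPS_add hpa analyticAt_const, taylorPS_const, taylorPS_const, taylorPS_const,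
    taylorPS_id] at e
  have c := fun n => congrArg (PowerSeries.coeff n) e
  have hc0 : p 0 = 1 := by rw [hp, coeff_zero_taylorPS, hp0]
  have hQ0 : PowerSeries.coeff 0 (taylorPS q) = 0 := by rw [coeff_zero_taylorPS, hq0]
  have c1 := c 1
  have c2 := c 2
  have c3 := c 3
  have c4 := c 4
  have c5 := c 5
  clear c e
  simp [PowerSeries.coeff_mul, Finset.Nat.antidiagonal_succ, PowerSeries.coeff_X,
    PowerSeries.coeff_one, PowerSeries.coeff_C, ← hp, hc0, hQ0, coeff_taylorPS_deriv,
    -PowerSeries.coeff_zero_eq_constantCoeff] at c1 c2 c3 c4 c5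
  have g1 := hqc 1
  have g2 := hqc 2
  have g3 := hqc 3
  have g4 := hqc 4
  have g5 := hqc 5
  generalize PowerSeries.coeff 1 (taylorPS q) = q1 at *
  generalize PowerSeries.coeff 2 (taylorPS q) = q2 at *
  generalize PowerSeries.coeff 3 (taylorPS q) = q3 at *
  generalize PowerSeries.coeff 4 (taylorPS q) = q4 at *
  generalize PowerSeries.coeff 5 (taylorPS q) = q5 at *
  push_cast at g1 g2 g3 g4 g5
  -- The factor `n + 1` multiplying `q_n` combines one `q_n` from `(1 + q) q` with `n q_n` from `z
  -- q'`; each solved value is substituted into the later equations.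
  have e1 : q1 = 3 / 4 * p 1 := by linear_combination (-1 / 2) * c1
  subst e1
  have e2 : q2 = 1 / 2 * p 2 + 3 / 16 * p 1 ^ 2 := by linear_combination (-1 / 3) * c2
  subst e2
  have e3 : q3 = 3 / 8 * p 3 + 9 / 32 * (p 1 * p 2) := by linear_combination (-1 / 4) * c3
  subst e3
  have e4 : q4 = 1 / 5 * (3 / 2 * p 4 + 1 / 2 * (p 2 * p 2)
      + 9 / 8 * (p 1 * (p 3 + 1 / 12 * (p 1 * p 2) - 1 / 32 * p 1 ^ 3))) := by
    linear_combination (-1 / 5) * c4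
  subst e4
  refine ⟨?_, ?_, ?_, ?_, ?_⟩
  · linear_combination (-1 / 2) * g1
  · linear_combination (-1 / 4) * g2
  · linear_combination (-1 / 6) * g3
  · linear_combination (-1 / 8) * g4
  · linear_combination (-1 / 10) * g5 - 1 / 60 * c5

theorem logCoeff_bounds {f : ℂ → ℂ} (hf : f ∈ ClassF 3) :
    ‖logCoeff f 1‖ ≤ 3 / 4 ∧ ‖logCoeff f 2‖ ≤ 7 / 16 ∧ ‖logCoeff f 3‖ ≤ 5 / 16 ∧
      ‖logCoeff f 4‖ ≤ 1 / 40 * (5 + 19 / 2 * Real.sqrt (76 / 303)) ∧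
      ‖logCoeff f 5‖ ≤ 1 / 60 * (69 / 8 + 33 / 4 * Real.sqrt (22 / 83)) := by
  obtain ⟨hd, hp0, hre⟩ := classFRe_spec hf
  obtain ⟨hB4, hB5⟩ := norm_caratheodory_third_le hd hp0 hre
  obtain ⟨p, hp⟩ : ∃ p : ℕ → ℂ, ∀ n, p n = PowerSeries.coeff n (taylorPS (classFRe f)) :=
    ⟨_, fun _ => rfl⟩
  have hb : ∀ n, n ≠ 0 → ‖p n‖ ≤ 2 := fun n hn => by
    rw [hp]; exact norm_coeff_le_two_of_re_pos hd hp0 hre hn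
  obtain ⟨e1, e2, e3, e4, e5⟩ := logCoeff_eq_caratheodory hf hp
  rw [← hp, ← hp, ← hp] at hB4 hB5
  have b1 := hb 1 (by norm_num)
  have b2 := hb 2 (by norm_num)
  have b3 := hb 3 (by norm_num)
  have b4 := hb 4 (by norm_num)
  have b5 := hb 5 (by norm_num)
  have hmul : ∀ {u v : ℂ} {A B : ℝ}, ‖u‖ ≤ A → ‖v‖ ≤ B → ‖u * v‖ ≤ A * B := fun hu hv => by
    rw [norm_mul]
    exact mul_le_mul hu hv (norm_nonneg _) ((norm_nonneg _).trans hu)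
  have hsc : ∀ (r : ℝ) {v : ℂ} {B : ℝ}, 0 ≤ r → ‖v‖ ≤ B → ‖(r : ℂ) * v‖ ≤ r * B :=
    fun r v B hr hv => hmul (by rw [Complex.norm_real, Real.norm_of_nonneg hr]) hv
  have hadd : ∀ {u v : ℂ} {A B : ℝ}, ‖u‖ ≤ A → ‖v‖ ≤ B → ‖u + v‖ ≤ A + B :=
    fun hu hv => norm_add_le_of_le hu hv
  refine ⟨?_, ?_, ?_, ?_, ?_⟩
  · have := hsc (3 / 8) (by norm_num) b1
    push_cast at this
    rw [e1]; linarith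
  · have := hsc (1 / 4) (by norm_num) (hadd (hsc (1 / 2) (by norm_num) b2)
      (hsc (3 / 16) (by norm_num) (hmul b1 b1)))
    push_cast at this
    rw [e2]; linarith
  · have := hsc (1 / 6) (by norm_num) (hadd (hsc (3 / 8) (by norm_num) b3)
      (hsc (9 / 32) (by norm_num) (hmul b1 b2)))
    push_cast at this
    rw [e3]; linarith
  · have := hsc (1 / 40) (by norm_num) (hadd (hadd (hsc (3 / 2) (by norm_num) b4)
      (hsc (1 / 2) (by norm_num) (hmul b2 b2))) (hsc (9 / 8) (by norm_num) (hmul b1 hB4)))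
    push_cast at this
    rw [e4]; linarith
  · have := hsc (1 / 60) (by norm_num) (hadd (hadd (hadd (hsc (3 / 2) (by norm_num) b5)
      (hsc (9 / 8) (by norm_num) (hmul b1 b4)))
      (hsc (9 / 64) (by norm_num) (hmul (hmul b1 b1) b3)))
      (hsc (15 / 16) (by norm_num) (hmul b2 hB5)))
    push_cast at this
    rw [e5]; linarith

/-! ### The extremal function `f₃`. -/

theorem one_sub_ne_zero_of_mem_ball {z : ℂ} (hz : z ∈ Metric.ball (0 : ℂ) 1) : 1 - z ≠ 0 := by
  intro h
  rw [mem_ball_zero_iff, ← sub_eq_zero.1 h] at hz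
  simp at hz

theorem hasDerivAt_fThree {z : ℂ} (hz : z ∈ Metric.ball (0 : ℂ) 1) :
    HasDerivAt fThree (1 / (1 - z) ^ 3) z := by
  have hne := one_sub_ne_zero_of_mem_ball hz
  have h1 : HasDerivAt (fun w : ℂ => w - w ^ 2 / 2) (1 - z) z :=
    ((hasDerivAt_id z).sub (((hasDerivAt_id z).pow 2).div_const 2)).congr_deriv (by simp)
  have h2 : HasDerivAt (fun w : ℂ => (1 - w) ^ 2) (-2 * (1 - z)) z :=
    (((hasDerivAt_id z).const_sub 1).pow 2).congr_deriv (by simp)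
  refine (h1.div h2 (pow_ne_zero 2 hne)).congr_deriv ?_
  field_simp
  ring

theorem deriv_fThree {z : ℂ} (hz : z ∈ Metric.ball (0 : ℂ) 1) :
    deriv fThree z = 1 / (1 - z) ^ 3 :=
  (hasDerivAt_fThree hz).deriv

theorem deriv_deriv_fThree {z : ℂ} (hz : z ∈ Metric.ball (0 : ℂ) 1) :
    deriv (deriv fThree) z = 3 / (1 - z) ^ 4 := by
  have hne := one_sub_ne_zero_of_mem_ball hz
  have hev : deriv fThree =ᶠ[nhds z] fun w => 1 / (1 - w) ^ 3 :=
    Filter.eventually_of_mem (Metric.isOpen_ball.mem_nhds hz) fun w hw => deriv_fThree hw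
  rw [hev.deriv_eq]
  have h2 : HasDerivAt (fun w : ℂ => (1 - w) ^ 3) (-3 * (1 - z) ^ 2) z :=
    (((hasDerivAt_id z).const_sub 1).pow 3).congr_deriv (by simp)
  have h3 := ((hasDerivAt_const z (1 : ℂ)).div h2 (pow_ne_zero 3 hne)).deriv
  refine h3.trans ?_
  field_simp
  ring

theorem fThree_mem_classF : fThree ∈ ClassF 3 := by
  have h0mem : (0 : ℂ) ∈ Metric.ball (0 : ℂ) 1 := Metric.mem_ball_self one_pos
  refine ⟨⟨fun z hz => (hasDerivAt_fThree hz).differentiableAt.differentiableWithinAt,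
    by simp [fThree], by rw [deriv_fThree h0mem]; simp⟩, fun z hz => ?_⟩
  have hne := one_sub_ne_zero_of_mem_ball hz
  rw [deriv_fThree hz, deriv_deriv_fThree hz]
  refine ⟨one_div_ne_zero (pow_ne_zero 3 hne), ?_⟩
  -- Membership reduces to the half-plane map `(1 + z)/(1 - z)` having positive real part.
  have e : 1 + z * (3 / (1 - z) ^ 4) / (1 / (1 - z) ^ 3)
      = -1 / 2 + ((3 / 2 : ℝ) : ℂ) * ((1 + z) / (1 - z)) := by
    push_cast; field_simp; ring
  have hpos : 0 < Complex.normSq (1 - z) := Complex.normSq_pos.2 hne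
  have hre : 0 < ((1 + z) / (1 - z)).re := by
    have hz1 : z.re * z.re + z.im * z.im < 1 := by
      rw [← Complex.normSq_apply, Complex.normSq_eq_norm_sq]
      have := mem_ball_zero_iff.1 hz
      nlinarith [norm_nonneg z]
    rw [Complex.div_re, ← add_div]
    refine div_pos ?_ hpos
    simp only [Complex.add_re, Complex.add_im, Complex.sub_re, Complex.sub_im, Complex.one_re,
      Complex.one_im]
    linarith
  rw [e, Complex.add_re, Complex.re_ofReal_mul]
  norm_num
  linarith

/-- Since `f₃(z)/z = (1 - z/2)/(1 - z)²`, its logarithm is `log(1 - z/2) - 2 log(1 - z)`, with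
`k`-th coefficient `2/k - 1/(k 2^k)`. -/
theorem logCoeff_fThree (k : ℕ) (hk : 1 ≤ k) :
    logCoeff fThree k = (1 - 1 / 2 ^ (k + 1)) * (1 / (k : ℂ)) := by
  have hhalf : ∀ z ∈ Metric.ball (0 : ℂ) 1, ‖z / 2‖ < 1 := fun z hz => by
    rw [norm_div, Complex.norm_ofNat]
    linarith [mem_ball_zero_iff.1 hz]
  have hslit : ∀ w : ℂ, ‖w‖ < 1 → 1 - w ∈ Complex.slitPlane := fun w hw => by
    simpa [sub_eq_add_neg] using Complex.mem_slitPlane_of_norm_lt_one (z := -w) (by simpa using hw)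
  refine logCoeff_eq_of_hasSum (γ := fun k => (1 - 1 / 2 ^ (k + 1)) * (1 / (k : ℂ)))
    (g := fun z => Complex.log (1 - z / 2) - 2 * Complex.log (1 - z)) fThree_mem_classF.1
    (fun z hz => ?_) (fun z hz hz0 => ?_) (fun z hz => ?_) k hk
  · have h1 : DifferentiableAt ℂ (fun z : ℂ => Complex.log (1 - z / 2)) z :=
      DifferentiableAt.clog (by fun_prop) (hslit _ (hhalf z hz))
    have h2 : DifferentiableAt ℂ (fun z : ℂ => Complex.log (1 - z)) z :=
      DifferentiableAt.clog (by fun_prop) (hslit _ (mem_ball_zero_iff.1 hz))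
    exact (h1.sub (h2.const_mul 2)).differentiableWithinAt
  · have hne := one_sub_ne_zero_of_mem_ball hz
    have hne2 := Complex.slitPlane_ne_zero (hslit _ (hhalf z hz))
    rw [Complex.exp_sub, Complex.exp_log hne2, two_mul, Complex.exp_add, Complex.exp_log hne,
      fThree]
    field_simp
  · have h1 := Complex.hasSum_taylorSeries_neg_log' (mem_ball_zero_iff.1 hz)
    have h2 := Complex.hasSum_taylorSeries_neg_log' (hhalf z hz)
    have h3 := (h1.mul_left 2).sub h2
    have e1 : (fun n : ℕ => 2 * ((1 - 1 / 2 ^ (n + 1 + 1)) * (1 / ((n + 1 : ℕ) : ℂ))) * z ^ (n + 1))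
        = fun n : ℕ => 2 * (z ^ (n + 1) / ((n : ℂ) + 1)) - (z / 2) ^ (n + 1) / ((n : ℂ) + 1) := by
      funext n
      have : (n : ℂ) + 1 ≠ 0 := by exact_mod_cast n.succ_ne_zero
      push_cast
      rw [div_pow]
      field_simp
      ring
    have e2 : Complex.log (1 - z / 2) - 2 * Complex.log (1 - z)
        = 2 * -Complex.log (1 - z) - -Complex.log (1 - z / 2) := by ring
    rw [e1, e2]
    exact h3

theorem mainTheorem7 :
    (∀ f ∈ ClassF 3,
      ‖logCoeff f 1‖ ≤ 3 / 4 ∧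
      ‖logCoeff f 2‖ ≤ 7 / 16 ∧
      ‖logCoeff f 3‖ ≤ 5 / 16 ∧
      ‖logCoeff f 4‖ ≤ 1 / 40 * (5 + 19 / 2 * Real.sqrt (76 / 303)) ∧
      ‖logCoeff f 5‖ ≤ 1 / 60 * (69 / 8 + 33 / 4 * Real.sqrt (22 / 83))) ∧
    fThree ∈ ClassF 3 ∧
    ‖logCoeff fThree 1‖ = 3 / 4 ∧
    ‖logCoeff fThree 2‖ = 7 / 16 ∧
    ‖logCoeff fThree 3‖ = 5 / 16 ∧
    ∀ k : ℕ, 1 ≤ k → logCoeff fThree k = (1 - 1 / 2 ^ (k + 1)) * (1 / (k : ℂ)) := by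
  refine ⟨fun f hf => logCoeff_bounds hf, fThree_mem_classF, ?_, ?_, ?_, logCoeff_fThree⟩
  · rw [logCoeff_fThree 1 le_rfl]
    norm_num
  · rw [logCoeff_fThree 2 (by norm_num)]
    norm_num
  · rw [logCoeff_fThree 3 (by norm_num)]
    norm_num
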